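/- Let $A\in\mathbb{R}^{n_x\times n_x}$ and $B\in\mathbb{R}^{n_x\times n_u}$ with $(A,B)$ controllable, let $Q\in\mathbb{R}^{n_x\times n_x}$ be symmetric positive semi-definite and $R\in\mathbb{R}^{n_u\times n_u}$ symmetric positive definite. Let $M,E\geqslant 1$ and $\hat\omega_k=\pi k/M$ for $k=0,\dots,M-1$. For vectors $V^e_k\in\mathbb{C}^{n}$ ($1\leqslant e\leqslant E$, $0\leqslant k\leqslant M-1$), $L\geqslant 1$ and $r\in\{0,1\}$, let $$\mathcal{F}_L(V_{[r,M-1]})=\begin{bmatrix} W_L(e^{j\hat\omega_r})\otimes[V^1_r\ \cdots\ V^E_r] & \cdots & W_L(e^{j\hat\omega_{M-1}})\otimes[V^1_{M-1}\ \cdots\ V^E_{M-1}]\end{bmatrix},\qquad W_L(z)=\begin{bmatrix}1& z&\cdots& z^{L-1}\end{bmatrix}^\top ,$$ and let $\mathcal{F}^*_L$ denote its entrywise complex conjugate. The collection $V$ is called collectively persistently exciting (CPE) of order $L$, $1\leqslant L\leqslant E(2M-1)$, if $[\mathcal{F}_L(V_{[0,M-1]})\ \ \mathcal{F}^*_L(V_{[1,M-1]})]$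 has full row rank. Let $U^e_k\in\mathbb{C}^{n_u}$ and $X^e_k\in\mathbb{C}^{n_x}$ be a collection of input-state spectra of the system $x_{k+1}=Ax_k+Bu_k$, i.e., $e^{j\hat\omega_k}X^e_k=AX^e_k+BU^e_k$ for all $e$ and $k$. Suppose that the collection $(U^e_k)$ is CPE of order $n_x+1$ and that every eigenvalue of $A$ on the unit circle is $(Q,A)$-observable, i.e., $\operatorname{rank}\begin{bmatrix}Q\\ \lambda I-A\end{bmatrix}=n_x$ for all $\lambda\in\mathbb{C}$ with $|\lambda|=1$. Let $$\Delta=\begin{bmatrix}X_0\\ X_1\\ \mathbf{U}\end{bmatrix},\qquad \begin{bmatrix}X_0\\ X_1\end{bmatrix}=\begin{bmatrix}\mathcal{F}_2(X_{[0,M-1]}) & \mathcal{F}_2^*(X_{[1,M-1]})\end{bmatrix},\qquad \mathbf{U}=\begin{bmatrix}\mathcal{F}_1(U_{[0,M-1]}) & \mathcal{F}_1^*(U_{[1,M-1]})\end{bmatrix},$$ where $X_0$ and $X_1$ have $n_x$ rows each, and let $\Psi(P)=\operatorname{diag}\{Q-P,P,R\}$. Then the problem of maximizing $\operatorname{trace}P$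 over all $P\in\mathbb{R}^{n_x\times n_x}$ with $\Delta^{\mathsf H}\Psi(P)\Delta\succcurlyeq 0$ and $P=P^\top\succcurlyeq 0$ has a unique solution $P$. Moreover, there is a gain $K\in\mathbb{R}^{n_u\times n_x}$ such that $u_k=Kx_k$ is the optimal control law that minimizes $\sum_{k\geqslant 0}x_k^\top Qx_k+u_k^\top Ru_k$ and achieves $\lim_{k\to\infty}x_k=0$: for every initial state $x_0$, a trajectory $(x_k,u_k)_{k\geqslant 0}$ of the system from $x_0$ has the least cost among all trajectories from $x_0$ with $x_k\to 0$, and itself satisfies $x_k\to 0$, if and only if $u_k=Kx_k$ for all $k\geqslant 0$. There exists a right inverse $X_0^\dagger$ of $X_0$ with $\Delta^{\mathsf H}\Psi(P)\Delta X_0^\dagger=0$, and for every such right inverse $$K=\mathbf{U}X_0^\dagger .$$ -/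

import Mathlib

noncomputable section

namespace FreqLQR

open Matrix Filter Topology
open scoped ComplexOrder ENNReal

/-! ### The system -/

/-- Controllability of `(A, B)`: the matrix `[B, AB, ..., A ^ (nx - 1) B]` has rank `nx`. -/
def IsControllable {nx nu : ℕ} (A : Matrix (Fin nx) (Fin nx) ℝ)
    (B : Matrix (Fin nx) (Fin nu) ℝ) : Prop :=
  (Matrix.of fun (i : Fin nx) (p : Fin nx × Fin nu) => (A ^ (p.1 : ℕ) * B) i p.2).rank = nx

/-- Every eigenvalue of `A` on the unit circle is `(Q, A)`-observable: the matrix with the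
block `Q` on top of the block `λ I - A` has full column rank whenever `|λ| = 1`. -/
def UnitCircleObservable {nx : ℕ} (Q A : Matrix (Fin nx) (Fin nx) ℝ) : Prop :=
  ∀ z : ℂ, ‖z‖ = 1 →
    (fromRows (Q.map Complex.ofReal)
      (z • (1 : Matrix (Fin nx) (Fin nx) ℂ) - A.map Complex.ofReal)).rank = nx

/-! ### Frequency-domain data

A collection of `E` sequences of length `M` of vectors in `ℂ ^ n` is a function
`V : Fin E → Fin M → Fin n → ℂ`, where `V e k` is the `k`-th sample in the `e`-th data set. -/

/-- The grid point `exp (j π k / M)` on the unit circle. -/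
def gridPoint (M k : ℕ) : ℂ :=
  Complex.exp (Complex.I * ((Real.pi * k / M : ℝ) : ℂ))

/-- `(U, X)` is a collection of input-state spectra of `x (k + 1) = A x k + B u k`. -/
def IsInputStateSpectra {nx nu M E : ℕ} (A : Matrix (Fin nx) (Fin nx) ℝ)
    (B : Matrix (Fin nx) (Fin nu) ℝ) (U : Fin E → Fin M → Fin nu → ℂ)
    (X : Fin E → Fin M → Fin nx → ℂ) : Prop :=
  ∀ (e : Fin E) (k : Fin M),
    gridPoint M k • X e k = A.map Complex.ofReal *ᵥ X e k + B.map Complex.ofReal *ᵥ U e k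

/-- The matrix built from the samples with `r ≤ k ≤ M - 1`: its block column for the frequency `k`
is `W_L(z) ⊗ [V 1 k, ..., V E k]` with `z = exp (j π k / M)` and
`W_L(z) = (1, z, ..., z ^ (L - 1))`. -/
def spectrumMatrix {n M E : ℕ} (L r : ℕ) (V : Fin E → Fin M → Fin n → ℂ) :
    Matrix (Fin L × Fin n) ({k : Fin M // r ≤ (k : ℕ)} × Fin E) ℂ :=
  Matrix.of fun p q => gridPoint M (q.1 : Fin M) ^ (p.1 : ℕ) * V q.2 q.1 p.2

/-- Index type for the columns of the data matrices: the frequencies `0, ..., M - 1` and then the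
mirrored frequencies `1, ..., M - 1`, each one with all the data sets. -/
abbrev Cols (M E : ℕ) : Type :=
  ({k : Fin M // 0 ≤ (k : ℕ)} × Fin E) ⊕ ({k : Fin M // 1 ≤ (k : ℕ)} × Fin E)

/-- The spectrum matrix of all the samples, next to the entrywise complex conjugate of the
spectrum matrix of the samples at nonzero frequencies. -/
def symSpectrumMatrix {n M E : ℕ} (L : ℕ) (V : Fin E → Fin M → Fin n → ℂ) :
    Matrix (Fin L × Fin n) (Cols M E) ℂ :=
  fromCols (spectrumMatrix L 0 V) ((spectrumMatrix L 1 V).map (starRingEnd ℂ))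

/-- Collective persistence of excitation of order `L`: full row rank of the matrix above. -/
def IsCPE {n M E : ℕ} (L : ℕ) (V : Fin E → Fin M → Fin n → ℂ) : Prop :=
  1 ≤ L ∧ L ≤ E * (2 * M - 1) ∧ (symSpectrumMatrix L V).rank = L * n

/-! ### The data matrices and the semidefinite program -/

/-- First block row of the depth-two matrix of the state data. -/
def dataX0 {nx M E : ℕ} (X : Fin E → Fin M → Fin nx → ℂ) : Matrix (Fin nx) (Cols M E) ℂ :=
  (symSpectrumMatrix 2 X).submatrix (fun i => (0, i)) id

/-- Second block row of the depth-two matrix of the state data. -/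
def dataX1 {nx M E : ℕ} (X : Fin E → Fin M → Fin nx → ℂ) : Matrix (Fin nx) (Cols M E) ℂ :=
  (symSpectrumMatrix 2 X).submatrix (fun i => (1, i)) id

/-- The depth-one matrix of the input data. -/
def dataU {nu M E : ℕ} (U : Fin E → Fin M → Fin nu → ℂ) : Matrix (Fin nu) (Cols M E) ℂ :=
  (symSpectrumMatrix 1 U).submatrix (fun i => (0, i)) id

/-- `Δ`, the matrices `X0`, `X1` and `U` on top of one another. -/
def dataDelta {nx nu M E : ℕ} (U : Fin E → Fin M → Fin nu → ℂ)
    (X : Fin E → Fin M → Fin nx → ℂ) :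
    Matrix ((Fin nx ⊕ Fin nx) ⊕ Fin nu) (Cols M E) ℂ :=
  fromRows (fromRows (dataX0 X) (dataX1 X)) (dataU U)

/-- `Ψ(P) = diag (Q - P, P, R)`. -/
def Psi {nx nu : ℕ} (Q : Matrix (Fin nx) (Fin nx) ℝ) (R : Matrix (Fin nu) (Fin nu) ℝ)
    (P : Matrix (Fin nx) (Fin nx) ℝ) :
    Matrix ((Fin nx ⊕ Fin nx) ⊕ Fin nu) ((Fin nx ⊕ Fin nx) ⊕ Fin nu) ℝ :=
  fromBlocks (fromBlocks (Q - P) 0 0 P) 0 0 R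

/-- `Δᴴ Ψ(P) Δ`. -/
def lmiMatrix {nx nu M E : ℕ} (Q : Matrix (Fin nx) (Fin nx) ℝ)
    (R : Matrix (Fin nu) (Fin nu) ℝ) (U : Fin E → Fin M → Fin nu → ℂ)
    (X : Fin E → Fin M → Fin nx → ℂ) (P : Matrix (Fin nx) (Fin nx) ℝ) :
    Matrix (Cols M E) (Cols M E) ℂ :=
  (dataDelta U X)ᴴ * (Psi Q R P).map Complex.ofReal * dataDelta U X

/-- The constraints `Δᴴ Ψ(P) Δ ⪰ 0` and `P = Pᵀ ⪰ 0`. -/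
def IsFeasible {nx nu M E : ℕ} (Q : Matrix (Fin nx) (Fin nx) ℝ)
    (R : Matrix (Fin nu) (Fin nu) ℝ) (U : Fin E → Fin M → Fin nu → ℂ)
    (X : Fin E → Fin M → Fin nx → ℂ) (P : Matrix (Fin nx) (Fin nx) ℝ) : Prop :=
  (lmiMatrix Q R U X P).PosSemidef ∧ P.PosSemidef

/-- `P` maximizes the trace subject to the constraints. -/
def IsMaximizer {nx nu M E : ℕ} (Q : Matrix (Fin nx) (Fin nx) ℝ)
    (R : Matrix (Fin nu) (Fin nu) ℝ) (U : Fin E → Fin M → Fin nu → ℂ)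
    (X : Fin E → Fin M → Fin nx → ℂ) (P : Matrix (Fin nx) (Fin nx) ℝ) : Prop :=
  IsFeasible Q R U X P ∧ ∀ P', IsFeasible Q R U X P' → P'.trace ≤ P.trace

/-! ### The linear-quadratic regulator problem -/

/-- `(x, u)` is a state-input trajectory on `k ≥ 0` with initial state `x0`. -/
def IsTrajectory {nx nu : ℕ} (A : Matrix (Fin nx) (Fin nx) ℝ) (B : Matrix (Fin nx) (Fin nu) ℝ)
    (x0 : Fin nx → ℝ) (x : ℕ → Fin nx → ℝ) (u : ℕ → Fin nu → ℝ) : Prop :=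
  x 0 = x0 ∧ ∀ k, x (k + 1) = A *ᵥ x k + B *ᵥ u k

/-- The cost `∑ k, (x k)ᵀ Q (x k) + (u k)ᵀ R (u k)`, a sum in `[0, ∞]`; its terms are nonnegative
for positive semidefinite `Q` and `R`. -/
def cost {nx nu : ℕ} (Q : Matrix (Fin nx) (Fin nx) ℝ) (R : Matrix (Fin nu) (Fin nu) ℝ)
    (x : ℕ → Fin nx → ℝ) (u : ℕ → Fin nu → ℝ) : ℝ≥0∞ :=
  ∑' k, ENNReal.ofReal (x k ⬝ᵥ (Q *ᵥ x k) + u k ⬝ᵥ (R *ᵥ u k))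

/-- `(x, u)` is a trajectory with initial state `x0` and `x k → 0` that has the least cost among
all such trajectories. -/
def IsOptimalTrajectory {nx nu : ℕ} (A : Matrix (Fin nx) (Fin nx) ℝ)
    (B : Matrix (Fin nx) (Fin nu) ℝ) (Q : Matrix (Fin nx) (Fin nx) ℝ)
    (R : Matrix (Fin nu) (Fin nu) ℝ) (x0 : Fin nx → ℝ) (x : ℕ → Fin nx → ℝ)
    (u : ℕ → Fin nu → ℝ) : Prop :=
  (IsTrajectory A B x0 x u ∧ Tendsto x atTop (𝓝 0)) ∧
    ∀ x' u', IsTrajectory A B x0 x' u' → Tendsto x' atTop (𝓝 0) → cost Q R x u ≤ cost Q R x' u'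

/-- `u k = K x k` is the optimal control law: for every initial state, the trajectories that
satisfy it are exactly the optimal ones. -/
def IsOptimalControlLaw {nx nu : ℕ} (A : Matrix (Fin nx) (Fin nx) ℝ)
    (B : Matrix (Fin nx) (Fin nu) ℝ) (Q : Matrix (Fin nx) (Fin nx) ℝ)
    (R : Matrix (Fin nu) (Fin nu) ℝ) (K : Matrix (Fin nu) (Fin nx) ℝ) : Prop :=
  ∀ x0 x u, IsTrajectory A B x0 x u →
    (IsOptimalTrajectory A B Q R x0 x u ↔ ∀ k, u k = K *ᵥ x k)

end FreqLQR

end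

/-!
The state equation turns `Δ` into `H Γ`, where `Γ` is the state data on top of the input data and
`H` depends on `A` and `B` only. Controllability and excitation of order `nx + 1` give `Γ` full row
rank (`eq_zero_of_forall_samples`, `exists_right_inverse_data`), so the constraint on the data is
equivalent to the dissipation inequality
`xᵀ P x ≤ xᵀ Q x + uᵀ R u + (A x + B u)ᵀ P (A x + B u)` for all real `x` and `u`
(`isFeasible_iff`). The matrices `P ⪰ 0` that satisfy it are called storage matrices below.

Storage matrices form a compact set, because controllability bounds them by the cost of steering to
the origin (`isCompact_isDissipative`). Hence a trace maximizer `P` exists. Partial minimization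
over `u` writes the dissipation inequality as `P ⪯ Ric P` with the Riccati operator `Ric`. This
operator is monotone, so `Ric P` is a storage matrix as well, and maximality of the trace forces
`Ric P = P` (`riccatiMap_eq_of_isMaxDissipative`).

Maximality also gives stability of the closed loop `A + B K`. An eigenvalue outside the closed unit
disk, with left eigenvector `w`, would make `P + s Re (w wᴴ)` a storage matrix of larger trace for
some `s > 0` (`norm_le_one_of_left_eigenvector`). An eigenvalue on the unit circle would be one of
`A`, with an eigenvector in the kernel of `Q` (`unobservable_of_closedLoop_eigenvector`).

Completion of squares along trajectories then shows that `u = K x` is the optimal control law, with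
cost `x0ᵀ P x0` (`isOptimalControlLaw_riccatiGain`). The dissipation inequality along the closed
loop shows that `P` dominates every storage matrix, hence is the only maximizer
(`posSemidef_sub_of_isDissipative`). A right inverse `G` of the state data satisfies the kernel
condition exactly if the dissipation matrix annihilates `[1; U G]`, and its lower block row then
determines `U G = K`.
-/

noncomputable section

namespace FreqLQR

open Matrix Filter Topology
open scoped ComplexOrder ENNReal

/-! ### Real quadratic forms -/

section QuadraticForms

variable {ι κ : Type*} [Fintype ι] [Fintype κ]

theorem dotProduct_mulVec_comm_of_isSymm {S : Matrix ι ι ℝ} (hS : S.IsSymm) (v w : ι → ℝ) :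
    v ⬝ᵥ (S *ᵥ w) = w ⬝ᵥ (S *ᵥ v) := by
  rw [dotProduct_mulVec, ← mulVec_transpose, hS, dotProduct_comm]

theorem posSemidef_iff_real {S : Matrix ι ι ℝ} :
    S.PosSemidef ↔ S.IsSymm ∧ ∀ x, 0 ≤ x ⬝ᵥ (S *ᵥ x) := by
  rw [posSemidef_iff_dotProduct_mulVec]
  simp [Matrix.IsHermitian, Matrix.IsSymm]

theorem isSymm_of_posSemidef {S : Matrix ι ι ℝ} (hS : S.PosSemidef) : S.IsSymm :=
  (posSemidef_iff_real.1 hS).1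

theorem form_nonneg_of_posSemidef {S : Matrix ι ι ℝ} (hS : S.PosSemidef) (x : ι → ℝ) :
    0 ≤ x ⬝ᵥ (S *ᵥ x) :=
  (posSemidef_iff_real.1 hS).2 x

theorem form_pos_of_posDef {S : Matrix ι ι ℝ} (hS : S.PosDef) {x : ι → ℝ} (hx : x ≠ 0) :
    0 < x ⬝ᵥ (S *ᵥ x) := by
  simpa using hS.dotProduct_mulVec_pos hx

theorem dotProduct_transpose_mul_mul_mulVec (P : Matrix ι ι ℝ) (A : Matrix ι κ ℝ)
    (x y : κ → ℝ) : x ⬝ᵥ ((Aᵀ * P * A) *ᵥ y) = (A *ᵥ x) ⬝ᵥ (P *ᵥ (A *ᵥ y)) := by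
  rw [← mulVec_mulVec, ← mulVec_mulVec, dotProduct_mulVec, vecMul_transpose]

/-- The Cauchy-Schwarz inequality for a positive definite form, with a constant that depends only
on `b`. -/
theorem exists_sq_dotProduct_le [DecidableEq ι] {S : Matrix ι ι ℝ} (hS : S.PosDef) (b : ι → ℝ) :
    ∃ C, 0 ≤ C ∧ ∀ d, (b ⬝ᵥ d) ^ 2 ≤ C * (d ⬝ᵥ (S *ᵥ d)) := by
  have hu : IsUnit S.det := (isUnit_iff_isUnit_det S).1 hS.isUnit
  set g := S⁻¹ *ᵥ b with hg
  have hSg : S *ᵥ g = b := by rw [hg, mulVec_mulVec, mul_nonsing_inv _ hu, one_mulVec]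
  have hC := form_nonneg_of_posSemidef hS.posSemidef g
  refine ⟨g ⬝ᵥ (S *ᵥ g), hC, fun d => ?_⟩
  have key := form_nonneg_of_posSemidef hS.posSemidef
    ((g ⬝ᵥ (S *ᵥ g)) • d - (b ⬝ᵥ d) • g)
  have e1 : d ⬝ᵥ (S *ᵥ g) = b ⬝ᵥ d := by rw [hSg, dotProduct_comm]
  have e2 : g ⬝ᵥ (S *ᵥ d) = b ⬝ᵥ d := by
    rw [dotProduct_mulVec_comm_of_isSymm (isSymm_of_posSemidef hS.posSemidef), e1]
  simp only [mulVec_sub, mulVec_smul, dotProduct_sub, sub_dotProduct, smul_dotProduct,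
    dotProduct_smul, smul_eq_mul, e1, e2] at key
  rcases hC.eq_or_lt with h0 | h0
  · have : g = 0 := by
      by_contra hne
      exact (form_pos_of_posDef hS hne).ne h0
    have hb : b = 0 := by rw [← hSg, this, mulVec_zero]
    simp [hb, ← h0]
  · nlinarith

theorem continuous_form (P : Matrix ι ι ℝ) :
    Continuous fun y : ι → ℝ => y ⬝ᵥ (P *ᵥ y) := by
  fun_prop

theorem isClosed_posSemidef : IsClosed {S : Matrix ι ι ℝ | S.PosSemidef} := by
  simp only [posSemidef_iff_real, Set.ofPred_and, Set.ofPred_forall]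
  refine (isClosed_eq (by fun_prop) (by fun_prop)).inter (isClosed_iInter fun x =>
    isClosed_le (by fun_prop) (by fun_prop))

theorem abs_apply_le_of_posSemidef [DecidableEq ι] {S : Matrix ι ι ℝ}
    (hS : S.PosSemidef) (i j : ι) : |S i j| ≤ S i i + S j j := by
  have hs := (isSymm_of_posSemidef hS).apply i j
  have h1 := form_nonneg_of_posSemidef hS (Pi.single i 1 + Pi.single j 1)
  have h2 := form_nonneg_of_posSemidef hS (Pi.single i 1 - Pi.single j 1)
  simp only [mulVec_add, mulVec_sub, mulVec_single_one, add_dotProduct, sub_dotProduct,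
    single_one_dotProduct, Pi.add_apply, Pi.sub_apply, col_apply, hs] at h1 h2
  have := hS.diag_nonneg (i := i)
  have := hS.diag_nonneg (i := j)
  rw [abs_le]
  constructor <;> linarith

end QuadraticForms

/-! ### Matrices of full row rank -/

section FullRowRank

variable {m n 𝕜 : Type*} [Fintype m] [Fintype n] [Field 𝕜]

theorem mulVec_surjective_of_rank {C : Matrix m n 𝕜} (h : C.rank = Fintype.card m) :
    Function.Surjective C.mulVec := by
  have : LinearMap.range C.mulVecLin = ⊤ := by
    apply Submodule.eq_top_of_finrank_eq
    rw [Module.finrank_fintype_fun_eq_card, ← h]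
    rfl
  exact LinearMap.range_eq_top.1 this

theorem eq_zero_of_vecMul_eq_zero_of_rank {C : Matrix m n 𝕜} (h : C.rank = Fintype.card m)
    {w : m → 𝕜} (hw : w ᵥ* C = 0) : w = 0 := by
  refine dotProduct_eq_zero w fun y => ?_
  obtain ⟨v, rfl⟩ := mulVec_surjective_of_rank h y
  rw [dotProduct_mulVec, hw, zero_dotProduct]

theorem exists_right_inverse_of_vecMul [DecidableEq m] {C : Matrix m n 𝕜}
    (h : ∀ w : m → 𝕜, w ᵥ* C = 0 → w = 0) : ∃ Z : Matrix n m 𝕜, C * Z = 1 := by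
  have hinj : Function.Injective C.vecMul := by
    refine (injective_iff_map_eq_zero C.vecMulLinear).2 fun w hw => h w hw
  have hli : LinearIndependent 𝕜 C.row := vecMul_injective_iff.1 hinj
  exact mulVec_surjective_iff_exists_right_inverse.1
    (mulVec_surjective_of_rank hli.rank_matrix)

end FullRowRank

/-! ### Real matrices as complex matrices -/

section Complexification

theorem conjTranspose_map_ofReal {m n : Type*} (S : Matrix m n ℝ) :
    (S.map Complex.ofReal)ᴴ = Sᵀ.map Complex.ofReal := by
  ext i j
  simp

theorem map_ofReal_mul {l m n : Type*} [Fintype m] (S : Matrix l m ℝ) (T : Matrix m n ℝ) :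
    (S * T).map Complex.ofReal = S.map Complex.ofReal * T.map Complex.ofReal :=
  Matrix.map_mul (f := Complex.ofRealHom)

theorem map_ofReal_add {m n : Type*} (S T : Matrix m n ℝ) :
    (S + T).map Complex.ofReal = S.map Complex.ofReal + T.map Complex.ofReal :=
  Matrix.map_add _ Complex.ofReal_add S T

theorem map_ofReal_sub {m n : Type*} (S T : Matrix m n ℝ) :
    (S - T).map Complex.ofReal = S.map Complex.ofReal - T.map Complex.ofReal :=
  Matrix.map_sub _ Complex.ofReal_sub S T

theorem re_map_ofReal_mulVec {ι κ : Type*} [Fintype ι] (S : Matrix κ ι ℝ) (v : ι → ℂ)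
    (i : κ) :
    ((S.map Complex.ofReal *ᵥ v) i).re = (S *ᵥ fun j => (v j).re) i := by
  simp [mulVec, dotProduct]

theorem im_map_ofReal_mulVec {ι κ : Type*} [Fintype ι] (S : Matrix κ ι ℝ) (v : ι → ℂ)
    (i : κ) :
    ((S.map Complex.ofReal *ᵥ v) i).im = (S *ᵥ fun j => (v j).im) i := by
  simp [mulVec, dotProduct]

theorem map_ofReal_pow {m : Type*} [Fintype m] [DecidableEq m] (S : Matrix m m ℝ) (k : ℕ) :
    (S ^ k).map Complex.ofReal = S.map Complex.ofReal ^ k :=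
  map_pow (Complex.ofRealHom.mapMatrix (m := m)) S k

open scoped MatrixOrder in
theorem posSemidef_map_ofReal_iff {ι : Type*} [Fintype ι] [DecidableEq ι] {S : Matrix ι ι ℝ} :
    (S.map Complex.ofReal).PosSemidef ↔ S.PosSemidef := by
  constructor
  · intro h
    refine posSemidef_iff_real.2 ⟨?_, fun x => ?_⟩
    · ext i j
      have := congrFun (congrFun h.1 i) j
      simpa using this
    · have := (Complex.le_def.1 (h.dotProduct_mulVec_nonneg fun i => (x i : ℂ))).1
      simpa [dotProduct, mulVec] using this
  · intro h
    obtain ⟨T, rfl⟩ := CStarAlgebra.nonneg_iff_eq_star_mul_self.1 h.nonneg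
    rw [star_eq_conjTranspose, conjTranspose_eq_transpose_of_trivial, map_ofReal_mul,
      ← conjTranspose_map_ofReal]
    exact posSemidef_conjTranspose_mul_self _

end Complexification

/-! ### The dissipation inequality and the Riccati operator -/

section Riccati

variable {ι κ : Type*} [Fintype ι] [Fintype κ]
variable (A : Matrix ι ι ℝ) (B : Matrix ι κ ℝ) (Q : Matrix ι ι ℝ) (R : Matrix κ κ ℝ)

/-- The matrix of the quadratic form
`xᵀ Q x + uᵀ R u + (A x + B u)ᵀ P (A x + B u) - xᵀ P x` in `(x, u)`. -/
def dissipationMatrix (P : Matrix ι ι ℝ) : Matrix (ι ⊕ κ) (ι ⊕ κ) ℝ :=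
  fromBlocks (Q + Aᵀ * P * A - P) (Aᵀ * P * B) (Bᵀ * P * A) (R + Bᵀ * P * B)

variable {A B Q R}
variable {P : Matrix ι ι ℝ}

theorem posDef_add_conj (hR : R.PosDef) (hP : P.PosSemidef) : (R + Bᵀ * P * B).PosDef := by
  have := hP.conjTranspose_mul_mul_same B
  rw [conjTranspose_eq_transpose_of_trivial] at this
  exact hR.add_posSemidef this

theorem form_dissipationMatrix (hP : P.PosSemidef) (x : ι → ℝ) (u : κ → ℝ) :
    Sum.elim x u ⬝ᵥ (dissipationMatrix A B Q R P *ᵥ Sum.elim x u) =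
      x ⬝ᵥ (Q *ᵥ x) + u ⬝ᵥ (R *ᵥ u) + (A *ᵥ x + B *ᵥ u) ⬝ᵥ (P *ᵥ (A *ᵥ x + B *ᵥ u)) -
        x ⬝ᵥ (P *ᵥ x) := by
  have e5 := dotProduct_mulVec_comm_of_isSymm (isSymm_of_posSemidef hP) (A *ᵥ x) (B *ᵥ u)
  have e6 : x ⬝ᵥ ((Aᵀ * P * B) *ᵥ u) = (A *ᵥ x) ⬝ᵥ (P *ᵥ (B *ᵥ u)) := by
    rw [← mulVec_mulVec, ← mulVec_mulVec, dotProduct_mulVec, vecMul_transpose]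
  have e7 : u ⬝ᵥ ((Bᵀ * P * A) *ᵥ x) = (B *ᵥ u) ⬝ᵥ (P *ᵥ (A *ᵥ x)) := by
    rw [← mulVec_mulVec, ← mulVec_mulVec, dotProduct_mulVec, vecMul_transpose]
  simp only [dissipationMatrix, fromBlocks_mulVec, Sum.elim_comp_inl, Sum.elim_comp_inr,
    sumElim_dotProduct_sumElim, sub_mulVec, add_mulVec, dotProduct_add, dotProduct_sub,
    dotProduct_transpose_mul_mul_mulVec, e6, e7, mulVec_add, add_dotProduct, e5]
  ring

/-- The dissipation inequality with storage function `xᵀ P x`, as a matrix inequality. -/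
theorem posSemidef_dissipationMatrix_iff (hQ : Q.PosSemidef) (hR : R.PosDef)
    (hP : P.PosSemidef) :
    (dissipationMatrix A B Q R P).PosSemidef ↔ ∀ x u, x ⬝ᵥ (P *ᵥ x) ≤
      x ⬝ᵥ (Q *ᵥ x) + u ⬝ᵥ (R *ᵥ u) + (A *ᵥ x + B *ᵥ u) ⬝ᵥ (P *ᵥ (A *ᵥ x + B *ᵥ u)) := by
  have hPs : Pᵀ = P := isSymm_of_posSemidef hP
  have hQs : Qᵀ = Q := isSymm_of_posSemidef hQ
  have hRs : Rᵀ = R := isSymm_of_posSemidef hR.posSemidef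
  rw [posSemidef_iff_real]
  constructor
  · rintro ⟨-, h⟩ x u
    have := h (Sum.elim x u)
    rw [form_dissipationMatrix hP] at this
    linarith
  · refine fun h => ⟨?_, fun z => ?_⟩
    · simp [Matrix.IsSymm, dissipationMatrix, fromBlocks_transpose, hPs, hQs, hRs,
        Matrix.mul_assoc]
    · rw [← Sum.elim_comp_inl_inr z, form_dissipationMatrix hP]
      linarith [h (z ∘ Sum.inl) (z ∘ Sum.inr)]

variable (A B Q R) in
/-- `P` is a storage matrix: `P ⪰ 0`, and `xᵀ P x` satisfies the dissipation inequality. These are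
the constraints of the semidefinite program, freed of the data matrices. -/
def IsDissipative (P : Matrix ι ι ℝ) : Prop :=
  (dissipationMatrix A B Q R P).PosSemidef ∧ P.PosSemidef

variable (A B Q R) in
/-- `P` maximizes the trace over the storage matrices. -/
def IsMaxDissipative (P : Matrix ι ι ℝ) : Prop :=
  IsDissipative A B Q R P ∧ ∀ P', IsDissipative A B Q R P' → P'.trace ≤ P.trace

variable [DecidableEq κ]

variable (A B R) in
/-- The feedback gain `K = -(R + Bᵀ P B)⁻¹ Bᵀ P A`, for which `u = K x` minimizes
`uᵀ R u + (A x + B u)ᵀ P (A x + B u)`. -/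
def riccatiGain (P : Matrix ι ι ℝ) : Matrix κ ι ℝ :=
  -((R + Bᵀ * P * B)⁻¹ * (Bᵀ * P * A))

variable (A B Q R) in
/-- The Riccati operator `P ↦ Q + Aᵀ P A - Kᵀ (R + Bᵀ P B) K`, where `K` is the gain of `P`.
Its fixed points are the solutions of the discrete-time algebraic Riccati equation. -/
def riccatiMap (P : Matrix ι ι ℝ) : Matrix ι ι ℝ :=
  Q + Aᵀ * P * A - (riccatiGain A B R P)ᵀ * (R + Bᵀ * P * B) * riccatiGain A B R P

theorem mul_riccatiGain (hR : R.PosDef) (hP : P.PosSemidef) :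
    (R + Bᵀ * P * B) * riccatiGain A B R P = -(Bᵀ * P * A) := by
  have hu := (isUnit_iff_isUnit_det _).1 (posDef_add_conj (B := B) hR hP).isUnit
  rw [riccatiGain, Matrix.mul_neg, ← Matrix.mul_assoc, mul_nonsing_inv _ hu, Matrix.one_mul]

/-- Completion of squares in the right-hand side of the Bellman equation. -/
theorem bellman_eq_riccatiMap_add_square (hR : R.PosDef) (hP : P.PosSemidef) (x : ι → ℝ)
    (u : κ → ℝ) :
    x ⬝ᵥ (Q *ᵥ x) + u ⬝ᵥ (R *ᵥ u) + (A *ᵥ x + B *ᵥ u) ⬝ᵥ (P *ᵥ (A *ᵥ x + B *ᵥ u)) =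
      x ⬝ᵥ (riccatiMap A B Q R P *ᵥ x) +
        (u - riccatiGain A B R P *ᵥ x) ⬝ᵥ
          ((R + Bᵀ * P * B) *ᵥ (u - riccatiGain A B R P *ᵥ x)) := by
  have hS := isSymm_of_posSemidef (posDef_add_conj (B := B) hR hP).posSemidef
  have e1 : u ⬝ᵥ ((R + Bᵀ * P * B) *ᵥ (riccatiGain A B R P *ᵥ x)) =
      -((B *ᵥ u) ⬝ᵥ (P *ᵥ (A *ᵥ x))) := by
    rw [mulVec_mulVec, mul_riccatiGain hR hP, neg_mulVec, dotProduct_neg, ← mulVec_mulVec,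
      ← mulVec_mulVec, dotProduct_mulVec, vecMul_transpose]
  have e2 : (riccatiGain A B R P *ᵥ x) ⬝ᵥ ((R + Bᵀ * P * B) *ᵥ u) =
      -((B *ᵥ u) ⬝ᵥ (P *ᵥ (A *ᵥ x))) := by
    rw [dotProduct_mulVec_comm_of_isSymm hS, e1]
  have e3 : u ⬝ᵥ ((R + Bᵀ * P * B) *ᵥ u) =
      u ⬝ᵥ (R *ᵥ u) + (B *ᵥ u) ⬝ᵥ (P *ᵥ (B *ᵥ u)) := by
    rw [add_mulVec, dotProduct_add, dotProduct_transpose_mul_mul_mulVec]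
  have e4 : x ⬝ᵥ (riccatiMap A B Q R P *ᵥ x) = x ⬝ᵥ (Q *ᵥ x) + (A *ᵥ x) ⬝ᵥ (P *ᵥ (A *ᵥ x)) -
      (riccatiGain A B R P *ᵥ x) ⬝ᵥ ((R + Bᵀ * P * B) *ᵥ (riccatiGain A B R P *ᵥ x)) := by
    rw [riccatiMap, sub_mulVec, add_mulVec, dotProduct_sub, dotProduct_add,
      dotProduct_transpose_mul_mul_mulVec, dotProduct_transpose_mul_mul_mulVec]
  have e5 := dotProduct_mulVec_comm_of_isSymm (isSymm_of_posSemidef hP) (A *ᵥ x) (B *ᵥ u)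
  rw [e4, mulVec_sub, dotProduct_sub, sub_dotProduct, sub_dotProduct, e1, e2, e3, mulVec_add,
    dotProduct_add, add_dotProduct, add_dotProduct, e5]
  ring

theorem isSymm_riccatiMap (hQ : Q.PosSemidef) (hR : R.PosDef) (hP : P.PosSemidef) :
    (riccatiMap A B Q R P).IsSymm := by
  have hPs : Pᵀ = P := isSymm_of_posSemidef hP
  have hQs : Qᵀ = Q := isSymm_of_posSemidef hQ
  have hRs : Rᵀ = R := isSymm_of_posSemidef hR.posSemidef
  simp [Matrix.IsSymm, riccatiMap, hPs, hQs, hRs, Matrix.mul_assoc]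

theorem posSemidef_dissipationMatrix_iff_riccatiMap (hQ : Q.PosSemidef) (hR : R.PosDef)
    (hP : P.PosSemidef) :
    (dissipationMatrix A B Q R P).PosSemidef ↔ (riccatiMap A B Q R P - P).PosSemidef := by
  rw [posSemidef_dissipationMatrix_iff hQ hR hP, posSemidef_iff_real]
  simp only [bellman_eq_riccatiMap_add_square hR hP, sub_mulVec, dotProduct_sub, sub_nonneg]
  constructor
  · intro h
    refine ⟨(isSymm_riccatiMap hQ hR hP).sub (isSymm_of_posSemidef hP), fun x => ?_⟩
    simpa using h x (riccatiGain A B R P *ᵥ x)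
  · rintro ⟨-, h⟩ x u
    have := form_nonneg_of_posSemidef (posDef_add_conj (B := B) hR hP).posSemidef
      (u - riccatiGain A B R P *ᵥ x)
    linarith [h x]

/-- The Riccati operator is a minimum over `u` of forms that increase with `P`; the proof
evaluates both forms at the minimizer for the larger matrix. -/
theorem riccatiMap_mono (hQ : Q.PosSemidef) (hR : R.PosDef) {P P' : Matrix ι ι ℝ}
    (hP : P.PosSemidef) (hPP' : (P' - P).PosSemidef) :
    (riccatiMap A B Q R P' - riccatiMap A B Q R P).PosSemidef := by
  have hP' : P'.PosSemidef := by simpa using hPP'.add hP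
  refine posSemidef_iff_real.2
    ⟨(isSymm_riccatiMap hQ hR hP').sub (isSymm_riccatiMap hQ hR hP), fun x => ?_⟩
  have h1 := bellman_eq_riccatiMap_add_square (A := A) (B := B) (Q := Q) hR hP x
    (riccatiGain A B R P' *ᵥ x)
  have h2 := bellman_eq_riccatiMap_add_square (A := A) (B := B) (Q := Q) hR hP' x
    (riccatiGain A B R P' *ᵥ x)
  have h3 := form_nonneg_of_posSemidef (posDef_add_conj (B := B) hR hP).posSemidef
    (riccatiGain A B R P' *ᵥ x - riccatiGain A B R P *ᵥ x)
  have h4 := form_nonneg_of_posSemidef hPP' (A *ᵥ x + B *ᵥ (riccatiGain A B R P' *ᵥ x))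
  simp only [sub_self, zero_dotProduct, add_zero] at h2
  rw [sub_mulVec, dotProduct_sub] at h4 ⊢
  linarith

/-- The Riccati operator maps the feasible set into itself and does not decrease `P`, so it fixes
every trace maximizer. -/
theorem riccatiMap_eq_of_isMaxDissipative (hQ : Q.PosSemidef) (hR : R.PosDef)
    (h : IsMaxDissipative A B Q R P) : riccatiMap A B Q R P = P := by
  obtain ⟨⟨h1, hP⟩, hmax⟩ := h
  have h2 := (posSemidef_dissipationMatrix_iff_riccatiMap hQ hR hP).1 h1
  have hP' : (riccatiMap A B Q R P).PosSemidef := by simpa using h2.add hP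
  have h3 := hmax _ ⟨(posSemidef_dissipationMatrix_iff_riccatiMap hQ hR hP').2
    (riccatiMap_mono hQ hR hP h2), hP'⟩
  have h4 := h2.trace_nonneg
  rw [trace_sub] at h4
  have h5 := (h2.trace_eq_zero_iff).1 (by rw [trace_sub]; linarith)
  exact sub_eq_zero.1 h5

end Riccati

/-! ### Eigenvectors and powers of a matrix -/

section Spectrum

variable {ι : Type*} [Fintype ι] [DecidableEq ι]

theorem exists_right_eigenvector {F : Matrix ι ι ℂ} {μ : ℂ} (h : μ ∈ spectrum ℂ F) :
    ∃ v ≠ 0, F *ᵥ v = μ • v := by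
  rw [spectrum.mem_iff, isUnit_iff_isUnit_det, isUnit_iff_ne_zero, not_not,
    ← exists_mulVec_eq_zero_iff] at h
  obtain ⟨v, hv, h⟩ := h
  refine ⟨v, hv, ?_⟩
  rw [Algebra.algebraMap_eq_smul_one, sub_mulVec, smul_mulVec, one_mulVec, sub_eq_zero] at h
  exact h.symm

theorem exists_left_eigenvector {F : Matrix ι ι ℂ} {μ : ℂ} (h : μ ∈ spectrum ℂ F) :
    ∃ w ≠ 0, w ᵥ* F = μ • w := by
  rw [spectrum.mem_iff, isUnit_iff_isUnit_det, isUnit_iff_ne_zero, not_not,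
    ← exists_vecMul_eq_zero_iff] at h
  obtain ⟨v, hv, h⟩ := h
  refine ⟨v, hv, ?_⟩
  rw [Algebra.algebraMap_eq_smul_one, vecMul_sub, vecMul_smul, vecMul_one, sub_eq_zero] at h
  exact h.symm

/-- A complex matrix whose spectrum lies in the open unit disk has powers that tend to zero, by
Gelfand's formula. -/
theorem tendsto_pow_mulVec_of_spectrum_complex {F : Matrix ι ι ℂ}
    (h : ∀ μ ∈ spectrum ℂ F, ‖μ‖ < 1) (x : ι → ℂ) :
    Tendsto (fun k : ℕ => F ^ k *ᵥ x) atTop (𝓝 0) := by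
  let _ : NormedRing (Matrix ι ι ℂ) := Matrix.linftyOpNormedRing
  let _ : NormedAlgebra ℂ (Matrix ι ι ℂ) := Matrix.linftyOpNormedAlgebra
  have : CompleteSpace (Matrix ι ι ℂ) := FiniteDimensional.complete ℂ _
  rcases isEmpty_or_nonempty ι with hι | hι
  · exact (tendsto_const_nhds (x := (0 : ι → ℂ))).congr fun k => Subsingleton.elim _ _
  have h1 : spectralRadius ℂ F < (1 : NNReal) :=
    spectrum.spectralRadius_lt_of_forall_lt F fun μ hμ => h μ hμ
  obtain ⟨r, hr1, hr2⟩ := ENNReal.lt_iff_exists_nnreal_btwn.1 h1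
  have h2 := (spectrum.pow_nnnorm_pow_one_div_tendsto_nhds_spectralRadius F).eventually
    (gt_mem_nhds hr1)
  have h3 : ∀ᶠ k : ℕ in atTop, ‖F ^ k‖ ≤ (r : ℝ) ^ k := by
    filter_upwards [h2, eventually_gt_atTop 0] with k hk hk0
    have hk' : (k : ℝ) ≠ 0 := by exact_mod_cast hk0.ne'
    have := ENNReal.rpow_le_rpow hk.le (Nat.cast_nonneg k : (0 : ℝ) ≤ k)
    rw [← ENNReal.rpow_mul, one_div, inv_mul_cancel₀ hk', ENNReal.rpow_one,
      ENNReal.rpow_natCast] at this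
    exact_mod_cast this
  refine squeeze_zero_norm' (a := fun k : ℕ => (r : ℝ) ^ k * ‖x‖) ?_ ?_
  · filter_upwards [h3] with k hk
    exact (Matrix.linfty_opNorm_mulVec _ _).trans
      (mul_le_mul_of_nonneg_right hk (norm_nonneg x))
  · have := (tendsto_pow_atTop_nhds_zero_of_lt_one r.2 (by exact_mod_cast hr2)).mul_const ‖x‖
    simpa using this

theorem tendsto_pow_mulVec_of_spectrum {F : Matrix ι ι ℝ}
    (h : ∀ μ ∈ spectrum ℂ (F.map Complex.ofReal), ‖μ‖ < 1) (x : ι → ℝ) :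
    Tendsto (fun k : ℕ => F ^ k *ᵥ x) atTop (𝓝 0) := by
  have h1 := tendsto_pow_mulVec_of_spectrum_complex h (fun i => (x i : ℂ))
  rw [tendsto_pi_nhds] at h1 ⊢
  intro i
  have h2 := (Complex.continuous_re.tendsto _).comp (h1 i)
  refine h2.congr fun k => ?_
  have h3 : (F.map Complex.ofReal) ^ k = (F ^ k).map Complex.ofReal :=
    (map_ofReal_pow F k).symm
  simp only [Function.comp, h3, re_map_ofReal_mulVec, Complex.ofReal_re]

end Spectrum

/-! ### Closed-loop eigenvalues -/

section Stability

variable {ι κ : Type*} [Fintype ι] [Fintype κ] [DecidableEq κ]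
variable {A : Matrix ι ι ℝ} {B : Matrix ι κ ℝ} {Q : Matrix ι ι ℝ} {R : Matrix κ κ ℝ}
variable {P : Matrix ι ι ℝ}

/-- For a solution of the Riccati equation, an eigenvector of the closed loop on the unit circle
costs nothing, so it is an eigenvector of `A` that `Q` does not see. -/
theorem unobservable_of_closedLoop_eigenvector (hQ : Q.PosSemidef) (hR : R.PosDef)
    (hP : P.PosSemidef) (hfix : riccatiMap A B Q R P = P) {μ : ℂ} (hμ : ‖μ‖ = 1) {v : ι → ℂ}
    (hv : (A + B * riccatiGain A B R P).map Complex.ofReal *ᵥ v = μ • v) :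
    Q.map Complex.ofReal *ᵥ v = 0 ∧ A.map Complex.ofReal *ᵥ v = μ • v := by
  set K := riccatiGain A B R P with hK
  set a : ι → ℝ := fun i => (v i).re with ha
  set b : ι → ℝ := fun i => (v i).im with hb
  have hFa : A *ᵥ a + B *ᵥ (K *ᵥ a) = μ.re • a - μ.im • b := by
    ext i
    have := congrArg Complex.re (congrFun hv i)
    rw [re_map_ofReal_mulVec, add_mulVec, ← mulVec_mulVec] at this
    simpa [ha, hb] using this
  have hFb : A *ᵥ b + B *ᵥ (K *ᵥ b) = μ.re • b + μ.im • a := by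
    ext i
    have := congrArg Complex.im (congrFun hv i)
    rw [im_map_ofReal_mulVec, add_mulVec, ← mulVec_mulVec] at this
    simpa [ha, hb] using this
  have hn : μ.re ^ 2 + μ.im ^ 2 = 1 := by
    have := Complex.sq_norm μ
    rw [hμ, Complex.normSq_apply] at this
    linarith
  have ea := bellman_eq_riccatiMap_add_square (A := A) (B := B) (Q := Q) hR hP a (K *ᵥ a)
  have eb := bellman_eq_riccatiMap_add_square (A := A) (B := B) (Q := Q) hR hP b (K *ᵥ b)
  rw [← hK, sub_self, zero_dotProduct, add_zero, hfix, hFa] at ea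
  rw [← hK, sub_self, zero_dotProduct, add_zero, hfix, hFb] at eb
  have hc := dotProduct_mulVec_comm_of_isSymm (isSymm_of_posSemidef hP) a b
  simp only [mulVec_sub, mulVec_add, mulVec_smul, dotProduct_sub, sub_dotProduct, dotProduct_add,
    add_dotProduct, smul_dotProduct, dotProduct_smul, smul_eq_mul, hc] at ea eb
  have hsum : a ⬝ᵥ (Q *ᵥ a) + b ⬝ᵥ (Q *ᵥ b) + (K *ᵥ a) ⬝ᵥ (R *ᵥ (K *ᵥ a)) +
      (K *ᵥ b) ⬝ᵥ (R *ᵥ (K *ᵥ b)) = 0 := by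
    linear_combination ea + eb - (a ⬝ᵥ (P *ᵥ a) + b ⬝ᵥ (P *ᵥ b)) * hn
  have q1 := form_nonneg_of_posSemidef hQ a
  have q2 := form_nonneg_of_posSemidef hQ b
  have r1 := form_nonneg_of_posSemidef hR.posSemidef (K *ᵥ a)
  have r2 := form_nonneg_of_posSemidef hR.posSemidef (K *ᵥ b)
  have hKa : K *ᵥ a = 0 := by
    by_contra hne
    linarith [form_pos_of_posDef hR hne]
  have hKb : K *ᵥ b = 0 := by
    by_contra hne
    linarith [form_pos_of_posDef hR hne]
  have hQa : Q *ᵥ a = 0 := (hQ.dotProduct_mulVec_zero_iff a).1 (by simpa using by linarith)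
  have hQb : Q *ᵥ b = 0 := (hQ.dotProduct_mulVec_zero_iff b).1 (by simpa using by linarith)
  rw [hKa, mulVec_zero, add_zero] at hFa
  rw [hKb, mulVec_zero, add_zero] at hFb
  constructor
  · ext i
    apply Complex.ext
    · rw [re_map_ofReal_mulVec, ← ha, hQa]; rfl
    · rw [im_map_ofReal_mulVec, ← hb, hQb]; rfl
  · ext i
    apply Complex.ext
    · rw [re_map_ofReal_mulVec, ← ha, hFa]; simp [ha, hb]
    · rw [im_map_ofReal_mulVec, ← hb, hFb]; simp [ha, hb]

/-- A left eigenvector `w = a + j b` of the closed loop for an eigenvalue outside the closed unit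
disk makes `P + s (a aᵀ + b bᵀ)` a storage matrix for a small `s > 0`, so `P` does not maximize
the trace. -/
theorem norm_le_one_of_left_eigenvector (hQ : Q.PosSemidef) (hR : R.PosDef)
    (h : IsMaxDissipative A B Q R P) {μ : ℂ} {w : ι → ℂ} (hw0 : w ≠ 0)
    (hw : w ᵥ* (A + B * riccatiGain A B R P).map Complex.ofReal = μ • w) : ‖μ‖ ≤ 1 := by
  by_contra! hμ
  have hfix := riccatiMap_eq_of_isMaxDissipative hQ hR h
  have hP := h.1.2
  set K := riccatiGain A B R P with hK
  set a : ι → ℝ := fun i => (w i).re with ha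
  set b : ι → ℝ := fun i => (w i).im with hb
  set m : ℝ := μ.re ^ 2 + μ.im ^ 2 with hm
  have hm1 : 1 < m := by
    have := Complex.sq_norm μ
    rw [Complex.normSq_apply] at this
    nlinarith
  rw [← mulVec_transpose, ← transpose_map] at hw
  have haF : ∀ x, a ⬝ᵥ (A *ᵥ x + B *ᵥ (K *ᵥ x)) = μ.re * (a ⬝ᵥ x) - μ.im * (b ⬝ᵥ x) := by
    intro x
    have : (A + B * K)ᵀ *ᵥ a = μ.re • a - μ.im • b := by
      ext i
      have := congrArg Complex.re (congrFun hw i)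
      rw [re_map_ofReal_mulVec] at this
      simpa [ha, hb] using this
    rw [mulVec_mulVec, ← add_mulVec, dotProduct_mulVec, ← mulVec_transpose, this, sub_dotProduct,
      smul_dotProduct, smul_dotProduct, smul_eq_mul, smul_eq_mul]
  have hbF : ∀ x, b ⬝ᵥ (A *ᵥ x + B *ᵥ (K *ᵥ x)) = μ.re * (b ⬝ᵥ x) + μ.im * (a ⬝ᵥ x) := by
    intro x
    have : (A + B * K)ᵀ *ᵥ b = μ.re • b + μ.im • a := by
      ext i
      have := congrArg Complex.im (congrFun hw i)
      rw [im_map_ofReal_mulVec] at this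
      simpa [ha, hb] using this
    rw [mulVec_mulVec, ← add_mulVec, dotProduct_mulVec, ← mulVec_transpose, this, add_dotProduct,
      smul_dotProduct, smul_dotProduct, smul_eq_mul, smul_eq_mul]
  have hRt := posDef_add_conj (B := B) hR hP
  obtain ⟨Ca, hCa, hCa'⟩ := exists_sq_dotProduct_le hRt (Bᵀ *ᵥ a)
  obtain ⟨Cb, hCb, hCb'⟩ := exists_sq_dotProduct_le hRt (Bᵀ *ᵥ b)
  -- The scale `s` makes the cost of the deviation `d` of the input from `K x` absorb the loss in
  -- `|μ ω + β| ^ 2 ≥ |ω| ^ 2 - |β| ^ 2 / (m - 1)`, where `ω = wᵀ x` and `β = wᵀ B d`.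
  set s : ℝ := (m - 1) / (Ca + Cb + 1) with hs
  have hs0 : 0 < s := div_pos (by linarith) (by linarith)
  set S : Matrix ι ι ℝ := s • (vecMulVec a a + vecMulVec b b) with hS
  have hform : ∀ x, x ⬝ᵥ (S *ᵥ x) = s * ((a ⬝ᵥ x) ^ 2 + (b ⬝ᵥ x) ^ 2) := by
    intro x
    rw [hS, smul_mulVec, add_mulVec, vecMulVec_mulVec, vecMulVec_mulVec]
    simp only [dotProduct_smul, dotProduct_add, smul_eq_mul, MulOpposite.smul_eq_mul_unop,
      MulOpposite.unop_op, dotProduct_comm x a, dotProduct_comm x b]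
    ring
  have hSpos : S.PosSemidef := by
    refine posSemidef_iff_real.2 ⟨?_, fun x => ?_⟩
    · simp [hS, Matrix.IsSymm, transpose_vecMulVec]
    · rw [hform]; positivity
  have hPS : (P + S).PosSemidef := hP.add hSpos
  have hdiss : (dissipationMatrix A B Q R (P + S)).PosSemidef := by
    rw [posSemidef_dissipationMatrix_iff hQ hR hPS]
    intro x u
    have e := bellman_eq_riccatiMap_add_square (A := A) (B := B) (Q := Q) hR hP x u
    rw [← hK, hfix] at e
    set d := u - K *ᵥ x with hd
    have hy : A *ᵥ x + B *ᵥ u = (A *ᵥ x + B *ᵥ (K *ᵥ x)) + B *ᵥ d := by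
      rw [hd, mulVec_sub]; abel
    have ya : a ⬝ᵥ (A *ᵥ x + B *ᵥ u) =
        μ.re * (a ⬝ᵥ x) - μ.im * (b ⬝ᵥ x) + (Bᵀ *ᵥ a) ⬝ᵥ d := by
      rw [hy, dotProduct_add, haF, dotProduct_mulVec a B d, mulVec_transpose]
    have yb : b ⬝ᵥ (A *ᵥ x + B *ᵥ u) =
        μ.re * (b ⬝ᵥ x) + μ.im * (a ⬝ᵥ x) + (Bᵀ *ᵥ b) ⬝ᵥ d := by
      rw [hy, dotProduct_add, hbF, dotProduct_mulVec b B d, mulVec_transpose]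
    have h1 := hCa' d
    have h2 := hCb' d
    have hr0 := form_nonneg_of_posSemidef hRt.posSemidef d
    rw [add_mulVec, dotProduct_add, add_mulVec, dotProduct_add, hform, hform, ya, yb]
    generalize a ⬝ᵥ x = p at *
    generalize b ⬝ᵥ x = q at *
    generalize (Bᵀ *ᵥ a) ⬝ᵥ d = f at *
    generalize (Bᵀ *ᵥ b) ⬝ᵥ d = g at *
    generalize d ⬝ᵥ ((R + Bᵀ * P * B) *ᵥ d) = r at *
    have hfg : s * (f ^ 2 + g ^ 2) ≤ (m - 1) * r := by
      have : s * (Ca + Cb + 1) = m - 1 := by rw [hs]; field_simp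
      rw [← this, mul_assoc]
      exact mul_le_mul_of_nonneg_left (by nlinarith) hs0.le
    -- The right-hand side is the square of the modulus of `(m - 1) ω + conj μ * β`.
    have hid : (m - 1) * ((μ.re * p - μ.im * q + f) ^ 2 + (μ.re * q + μ.im * p + g) ^ 2) -
        (m - 1) * (p ^ 2 + q ^ 2) + (f ^ 2 + g ^ 2) =
        ((m - 1) * p + (μ.re * f + μ.im * g)) ^ 2 +
          ((m - 1) * q + (μ.re * g - μ.im * f)) ^ 2 := by
      rw [hm]; ring
    have hid' : 0 ≤ s * ((m - 1) * ((μ.re * p - μ.im * q + f) ^ 2 +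
        (μ.re * q + μ.im * p + g) ^ 2) - (m - 1) * (p ^ 2 + q ^ 2) + (f ^ 2 + g ^ 2)) := by
      rw [hid]; positivity
    have : 0 ≤ (m - 1) * (r + s * ((μ.re * p - μ.im * q + f) ^ 2 +
        (μ.re * q + μ.im * p + g) ^ 2) - s * (p ^ 2 + q ^ 2)) := by linarith
    have := nonneg_of_mul_nonneg_right this (by linarith : 0 < m - 1)
    linarith
  have htr := h.2 _ ⟨hdiss, hPS⟩
  rw [trace_add] at htr
  have hS0 : S = 0 := hSpos.trace_eq_zero_iff.1 (le_antisymm (by linarith) hSpos.trace_nonneg)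
  have hz : ∀ i, a i = 0 ∧ b i = 0 := by
    intro i
    have := congrFun (congrFun hS0 i) i
    simp only [hS, Matrix.smul_apply, Matrix.add_apply, vecMulVec_apply, smul_eq_mul,
      Matrix.zero_apply] at this
    have := (mul_eq_zero.1 this).resolve_left hs0.ne'
    constructor <;> nlinarith
  exact hw0 (funext fun i => Complex.ext (hz i).1 (hz i).2)

end Stability

/-! ### Trajectories, storage matrices and the optimal cost -/

section Trajectories

variable {nx nu : ℕ} {A : Matrix (Fin nx) (Fin nx) ℝ} {B : Matrix (Fin nx) (Fin nu) ℝ}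
  {Q : Matrix (Fin nx) (Fin nx) ℝ} {R : Matrix (Fin nu) (Fin nu) ℝ}
  {P : Matrix (Fin nx) (Fin nx) ℝ}
  {x0 : Fin nx → ℝ} {x : ℕ → Fin nx → ℝ} {u : ℕ → Fin nu → ℝ}

theorem exists_isTrajectory_terminal_zero (hAB : IsControllable A B) (x0 : Fin nx → ℝ) :
    ∃ x u, IsTrajectory A B x0 x u ∧ x nx = 0 := by
  obtain ⟨v, hv⟩ := mulVec_surjective_of_rank (C := Matrix.of fun (i : Fin nx)
    (p : Fin nx × Fin nu) => (A ^ (p.1 : ℕ) * B) i p.2) (by simpa [IsControllable] using hAB)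
    (-(A ^ nx *ᵥ x0))
  -- The block of `v` that the power `A ^ p` multiplies is applied at time `nx - 1 - p`.
  let u : ℕ → Fin nu → ℝ := fun k j => if h : nx - 1 - k < nx then v (⟨nx - 1 - k, h⟩, j) else 0
  let x : ℕ → Fin nx → ℝ := fun k => Nat.rec x0 (fun k y => A *ᵥ y + B *ᵥ u k) k
  have hx : IsTrajectory A B x0 x u := ⟨rfl, fun k => rfl⟩
  have hsol : ∀ k, x k = A ^ k *ᵥ x0 +
      ∑ i ∈ Finset.range k, (A ^ (k - 1 - i) * B) *ᵥ u i := by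
    intro k
    induction k with
    | zero => simp [hx.1]
    | succ k ih =>
      rw [hx.2, ih, Finset.sum_range_succ, mulVec_add, mulVec_mulVec, ← pow_succ', mulVec_sum,
        add_assoc]
      simp only [Nat.add_sub_cancel, Nat.sub_self, pow_zero, Matrix.one_mul]
      congr 2
      refine Finset.sum_congr rfl fun i hi => ?_
      have hi' := Finset.mem_range.1 hi
      rw [mulVec_mulVec, ← Matrix.mul_assoc, ← pow_succ', show k - 1 - i + 1 = k - i by omega]
  refine ⟨x, u, hx, ?_⟩
  rw [hsol, ← neg_eq_iff_add_eq_zero, ← hv]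
  rw [← Finset.sum_range_reflect]
  rw [← Fin.sum_univ_eq_sum_range (fun i => (A ^ (nx - 1 - (nx - 1 - i)) * B) *ᵥ u (nx - 1 - i))]
  ext i
  simp only [mulVec, dotProduct, of_apply, Fintype.sum_prod_type, Finset.sum_apply]
  refine Finset.sum_congr rfl fun p _ => Finset.sum_congr rfl fun j _ => ?_
  have hp : nx - 1 - (nx - 1 - (p : ℕ)) = p := by omega
  simp [u, hp]

theorem form_le_sum_of_isDissipative (hQ : Q.PosSemidef) (hR : R.PosDef)
    (hP : IsDissipative A B Q R P) (h : IsTrajectory A B x0 x u) (N : ℕ) :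
    x0 ⬝ᵥ (P *ᵥ x0) ≤ ∑ k ∈ Finset.range N, (x k ⬝ᵥ (Q *ᵥ x k) + u k ⬝ᵥ (R *ᵥ u k)) +
      x N ⬝ᵥ (P *ᵥ x N) := by
  induction N with
  | zero => simp [h.1]
  | succ N ih =>
    have := (posSemidef_dissipationMatrix_iff hQ hR hP.2).1 hP.1 (x N) (u N)
    rw [← h.2] at this
    rw [Finset.sum_range_succ]
    linarith

theorem sum_cost_eq_of_riccatiMap_eq (hR : R.PosDef) (hP : P.PosSemidef)
    (hfix : riccatiMap A B Q R P = P) (h : IsTrajectory A B x0 x u) (N : ℕ) :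
    ∑ k ∈ Finset.range N, (x k ⬝ᵥ (Q *ᵥ x k) + u k ⬝ᵥ (R *ᵥ u k)) =
      x0 ⬝ᵥ (P *ᵥ x0) - x N ⬝ᵥ (P *ᵥ x N) +
        ∑ k ∈ Finset.range N, (u k - riccatiGain A B R P *ᵥ x k) ⬝ᵥ
          ((R + Bᵀ * P * B) *ᵥ (u k - riccatiGain A B R P *ᵥ x k)) := by
  induction N with
  | zero => simp [h.1]
  | succ N ih =>
    have := bellman_eq_riccatiMap_add_square (A := A) (B := B) (Q := Q) hR hP (x N) (u N)
    rw [← h.2, hfix] at this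
    rw [Finset.sum_range_succ, Finset.sum_range_succ, ih]
    linarith

theorem tendsto_form_zero (hx : Tendsto x atTop (𝓝 0)) (P : Matrix (Fin nx) (Fin nx) ℝ) :
    Tendsto (fun k => x k ⬝ᵥ (P *ᵥ x k)) atTop (𝓝 0) := by
  have := ((continuous_form P).tendsto 0).comp hx
  simpa [Function.comp_def] using this

theorem sum_ofReal_cost_eq (hQ : Q.PosSemidef) (hR : R.PosDef) (N : ℕ) :
    ∑ k ∈ Finset.range N, ENNReal.ofReal (x k ⬝ᵥ (Q *ᵥ x k) + u k ⬝ᵥ (R *ᵥ u k)) =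
      ENNReal.ofReal (∑ k ∈ Finset.range N, (x k ⬝ᵥ (Q *ᵥ x k) + u k ⬝ᵥ (R *ᵥ u k))) :=
  (ENNReal.ofReal_sum_of_nonneg fun _ _ => add_nonneg (form_nonneg_of_posSemidef hQ _)
    (form_nonneg_of_posSemidef hR.posSemidef _)).symm

/-- Every deviation of the input from `K x` adds to the cost of a trajectory that tends to zero. -/
theorem le_cost_of_tendsto_zero (hQ : Q.PosSemidef) (hR : R.PosDef) (hP : P.PosSemidef)
    (hfix : riccatiMap A B Q R P = P) (h : IsTrajectory A B x0 x u)
    (hx : Tendsto x atTop (𝓝 0)) (j : ℕ) :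
    ENNReal.ofReal (x0 ⬝ᵥ (P *ᵥ x0) + (u j - riccatiGain A B R P *ᵥ x j) ⬝ᵥ
      ((R + Bᵀ * P * B) *ᵥ (u j - riccatiGain A B R P *ᵥ x j))) ≤ cost Q R x u := by
  have hRt := posDef_add_conj (B := B) hR hP
  set q : ℕ → ℝ := fun k => (u k - riccatiGain A B R P *ᵥ x k) ⬝ᵥ
    ((R + Bᵀ * P * B) *ᵥ (u k - riccatiGain A B R P *ᵥ x k)) with hq
  have h1 : Tendsto (fun N => ENNReal.ofReal (x0 ⬝ᵥ (P *ᵥ x0) - x N ⬝ᵥ (P *ᵥ x N) + q j)) atTop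
      (𝓝 (ENNReal.ofReal (x0 ⬝ᵥ (P *ᵥ x0) + q j))) := by
    refine ENNReal.tendsto_ofReal ?_
    simpa using ((tendsto_form_zero hx P).const_sub (x0 ⬝ᵥ (P *ᵥ x0))).add_const (q j)
  refine le_of_tendsto_of_tendsto h1 (ENNReal.tendsto_nat_tsum _) ?_
  filter_upwards [eventually_gt_atTop j] with N hN
  rw [sum_ofReal_cost_eq hQ hR, sum_cost_eq_of_riccatiMap_eq hR hP hfix h]
  refine ENNReal.ofReal_le_ofReal (add_le_add_right ?_ _)
  exact Finset.single_le_sum (f := q)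
    (fun k _ => form_nonneg_of_posSemidef hRt.posSemidef _) (Finset.mem_range.2 hN)

theorem cost_feedback_le (hQ : Q.PosSemidef) (hR : R.PosDef) (hP : P.PosSemidef)
    (hfix : riccatiMap A B Q R P = P) (h : IsTrajectory A B x0 x u)
    (hu : ∀ k, u k = riccatiGain A B R P *ᵥ x k) :
    cost Q R x u ≤ ENNReal.ofReal (x0 ⬝ᵥ (P *ᵥ x0)) := by
  refine ENNReal.tsum_le_of_sum_range_le fun N => ?_
  rw [sum_ofReal_cost_eq hQ hR, sum_cost_eq_of_riccatiMap_eq hR hP hfix h]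
  refine ENNReal.ofReal_le_ofReal ?_
  have := form_nonneg_of_posSemidef hP (x N)
  simpa [hu] using this

theorem isTrajectory_feedback (K : Matrix (Fin nu) (Fin nx) ℝ) (x0 : Fin nx → ℝ) :
    IsTrajectory A B x0 (fun k => (A + B * K) ^ k *ᵥ x0)
      (fun k => K *ᵥ ((A + B * K) ^ k *ᵥ x0)) := by
  refine ⟨by simp, fun k => ?_⟩
  dsimp only
  rw [mulVec_mulVec _ B K, ← add_mulVec, mulVec_mulVec, ← pow_succ']

theorem eq_pow_mulVec_of_feedback {K : Matrix (Fin nu) (Fin nx) ℝ} (h : IsTrajectory A B x0 x u)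
    (hu : ∀ k, u k = K *ᵥ x k) (k : ℕ) : x k = (A + B * K) ^ k *ᵥ x0 := by
  induction k with
  | zero => simp [h.1]
  | succ k ih =>
    rw [h.2, hu, mulVec_mulVec _ B K, ← add_mulVec, ih, mulVec_mulVec, ← pow_succ']

theorem isOptimalControlLaw_riccatiGain (hQ : Q.PosSemidef) (hR : R.PosDef) (hP : P.PosSemidef)
    (hfix : riccatiMap A B Q R P = P)
    (hstab : ∀ x0, Tendsto (fun k : ℕ => (A + B * riccatiGain A B R P) ^ k *ᵥ x0) atTop (𝓝 0)) :
    IsOptimalControlLaw A B Q R (riccatiGain A B R P) := by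
  have hRt := posDef_add_conj (B := B) hR hP
  intro x0 x u h
  constructor
  · rintro ⟨⟨-, hx⟩, hopt⟩ j
    have hf := isTrajectory_feedback (A := A) (B := B) (riccatiGain A B R P) x0
    have h1 := (le_cost_of_tendsto_zero hQ hR hP hfix h hx j).trans
      ((hopt _ _ hf (hstab x0)).trans (cost_feedback_le hQ hR hP hfix hf fun k => rfl))
    rw [ENNReal.ofReal_le_ofReal_iff (form_nonneg_of_posSemidef hP x0)] at h1
    by_contra hne
    linarith [form_pos_of_posDef hRt (sub_ne_zero.2 hne)]
  · intro hu
    have hx : Tendsto x atTop (𝓝 0) :=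
      (hstab x0).congr fun k => (eq_pow_mulVec_of_feedback h hu k).symm
    refine ⟨⟨h, hx⟩, fun x' u' h' hx' => (cost_feedback_le hQ hR hP hfix h hu).trans
      (le_trans (ENNReal.ofReal_le_ofReal ?_) (le_cost_of_tendsto_zero hQ hR hP hfix h' hx' 0))⟩
    exact le_add_of_nonneg_right (form_nonneg_of_posSemidef hRt.posSemidef _)

/-- A storage matrix bounds the cost from below along every trajectory that tends to zero, so a
stabilizing solution of the Riccati equation dominates all storage matrices. -/
theorem posSemidef_sub_of_isDissipative (hQ : Q.PosSemidef) (hR : R.PosDef) (hP : P.PosSemidef)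
    (hfix : riccatiMap A B Q R P = P)
    (hstab : ∀ x0, Tendsto (fun k : ℕ => (A + B * riccatiGain A B R P) ^ k *ᵥ x0) atTop (𝓝 0))
    {P' : Matrix (Fin nx) (Fin nx) ℝ} (hP' : IsDissipative A B Q R P') :
    (P - P').PosSemidef := by
  refine posSemidef_iff_real.2
    ⟨(isSymm_of_posSemidef hP).sub (isSymm_of_posSemidef hP'.2), fun x0 => ?_⟩
  have hf := isTrajectory_feedback (A := A) (B := B) (riccatiGain A B R P) x0
  have h1 := (tendsto_form_zero (hstab x0) P').const_add (x0 ⬝ᵥ (P *ᵥ x0))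
  rw [sub_mulVec, dotProduct_sub, sub_nonneg]
  rw [add_zero] at h1
  refine ge_of_tendsto' h1 fun N => ?_
  have h2 := form_le_sum_of_isDissipative hQ hR hP' hf N
  rw [sum_cost_eq_of_riccatiMap_eq hR hP hfix hf] at h2
  have h3 := form_nonneg_of_posSemidef hP ((A + B * riccatiGain A B R P) ^ N *ᵥ x0)
  simp only [sub_self, zero_dotProduct, Finset.sum_const_zero, add_zero] at h2
  linarith

/-- Storage matrices form a compact set: steering a basis vector to zero in `nx` steps has a
finite cost, which bounds the diagonal entries of every one of them. -/
theorem isCompact_isDissipative (hAB : IsControllable A B) (hQ : Q.PosSemidef) (hR : R.PosDef) :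
    IsCompact {P | IsDissipative A B Q R P} := by
  choose x u h hx using fun i : Fin nx =>
    exists_isTrajectory_terminal_zero hAB (Pi.single i 1)
  set C : Fin nx → ℝ := fun i => ∑ k ∈ Finset.range nx,
    (x i k ⬝ᵥ (Q *ᵥ x i k) + u i k ⬝ᵥ (R *ᵥ u i k)) with hC
  have hdiag : ∀ P, IsDissipative A B Q R P → ∀ i, P i i ≤ C i := by
    intro P hP i
    have := form_le_sum_of_isDissipative hQ hR hP (h i) nx
    simpa [hx, mulVec_single_one] using this
  have hbox : IsCompact (Set.pi Set.univ fun i : Fin nx => Set.pi Set.univ fun j : Fin nx =>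
      Set.Icc (-(C i + C j)) (C i + C j)) :=
    isCompact_univ_pi fun i => isCompact_univ_pi fun j => isCompact_Icc
  refine hbox.of_isClosed_subset ?_ ?_
  · refine IsClosed.inter (isClosed_posSemidef.preimage ?_) isClosed_posSemidef
    unfold dissipationMatrix
    fun_prop
  · intro P hP i _ j _
    have := abs_apply_le_of_posSemidef hP.2 i j
    have h1 := hdiag P hP i
    have h2 := hdiag P hP j
    exact abs_le.1 (by linarith)

theorem exists_isMaxDissipative (hAB : IsControllable A B) (hQ : Q.PosSemidef) (hR : R.PosDef) :
    ∃ P, IsMaxDissipative A B Q R P := by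
  have hne : {P | IsDissipative A B Q R P}.Nonempty := by
    refine ⟨0, (posSemidef_dissipationMatrix_iff hQ hR .zero).2 fun x u => ?_, .zero⟩
    have := form_nonneg_of_posSemidef hQ x
    have := form_nonneg_of_posSemidef hR.posSemidef u
    simp only [zero_mulVec, dotProduct_zero, add_zero]
    linarith
  obtain ⟨P, hP, hmax⟩ := (isCompact_isDissipative hAB hQ hR).exists_isMaxOn hne
    (f := Matrix.trace) (by fun_prop)
  exact ⟨P, hP, fun P' hP' => hmax hP'⟩

theorem tendsto_closedLoop_of_isMaxDissipative (hQ : Q.PosSemidef) (hR : R.PosDef)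
    (hobs : UnitCircleObservable Q A) (h : IsMaxDissipative A B Q R P) (x0 : Fin nx → ℝ) :
    Tendsto (fun k : ℕ => (A + B * riccatiGain A B R P) ^ k *ᵥ x0) atTop (𝓝 0) := by
  refine tendsto_pow_mulVec_of_spectrum (fun μ hμ => ?_) x0
  obtain ⟨w, hw0, hw⟩ := exists_left_eigenvector hμ
  refine (norm_le_one_of_left_eigenvector hQ hR h hw0 hw).lt_of_ne fun h1 => ?_
  obtain ⟨v, hv0, hv⟩ := exists_right_eigenvector hμ
  obtain ⟨hQv, hAv⟩ := unobservable_of_closedLoop_eigenvector hQ hR h.1.2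
    (riccatiMap_eq_of_isMaxDissipative hQ hR h) h1 hv
  refine hv0 (eq_zero_of_vecMul_eq_zero_of_rank (C := (fromRows (Q.map Complex.ofReal)
    (μ • (1 : Matrix (Fin nx) (Fin nx) ℂ) - A.map Complex.ofReal))ᵀ) ?_ ?_)
  · rw [rank_transpose, hobs μ h1, Fintype.card_fin]
  · rw [vecMul_transpose, fromRows_mulVec, hQv, sub_mulVec, smul_mulVec, one_mulVec, hAv,
      sub_self]
    ext i
    cases i <;> rfl

end Trajectories

/-! ### Persistency of excitation -/

section Excitation

variable {nx nu : ℕ} {A : Matrix (Fin nx) (Fin nx) ℝ} {B : Matrix (Fin nx) (Fin nu) ℝ}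

theorem eq_zero_of_vecMul_pow_mul_eq_zero (hAB : IsControllable A B) {ξ : Fin nx → ℂ}
    (h : ∀ j < nx, ξ ᵥ* ((A ^ j * B).map Complex.ofReal) = 0) : ξ = 0 := by
  have hker : ∀ a : Fin nx → ℝ, (∀ j < nx, a ᵥ* (A ^ j * B) = 0) → a = 0 := by
    intro a ha
    refine eq_zero_of_vecMul_eq_zero_of_rank (C := Matrix.of fun (i : Fin nx)
      (p : Fin nx × Fin nu) => (A ^ (p.1 : ℕ) * B) i p.2) (by simpa [IsControllable] using hAB) ?_
    ext p
    exact congrFun (ha p.1 p.1.2) p.2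
  have hre := hker (fun i => (ξ i).re) fun j hj => by
    ext p
    have := congrArg Complex.re (congrFun (h j hj) p)
    rw [← mulVec_transpose, ← transpose_map, re_map_ofReal_mulVec] at this
    rwa [← mulVec_transpose]
  have him := hker (fun i => (ξ i).im) fun j hj => by
    ext p
    have := congrArg Complex.im (congrFun (h j hj) p)
    rw [← mulVec_transpose, ← transpose_map, im_map_ofReal_mulVec] at this
    rwa [← mulVec_transpose]
  exact funext fun i => Complex.ext (congrFun hre i) (congrFun him i)

/-- The fundamental lemma in the frequency domain. A relation `ξᵀ x + ηᵀ u = 0` satisfied by all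
the samples propagates under multiplication by `z` to relations between `ξᵀ A ^ l x` and the
vectors `z ^ i u`. The combination of these with the coefficients of the characteristic polynomial
of `A` contains no `x` any more, so excitation of order `nx + 1` makes all its coefficients vanish;
they determine `η` and the `ξᵀ A ^ j B` recursively. -/
theorem eq_zero_of_forall_samples {C : Type*} (hAB : IsControllable A B) {z : C → ℂ}
    {x : C → Fin nx → ℂ} {u : C → Fin nu → ℂ}
    (hz : ∀ c, z c • x c = A.map Complex.ofReal *ᵥ x c + B.map Complex.ofReal *ᵥ u c)
    (hu : ∀ θ : Fin (nx + 1) → Fin nu → ℂ,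
      (∀ c, ∑ l : Fin (nx + 1), z c ^ (l : ℕ) * (θ l ⬝ᵥ u c) = 0) → ∀ l, θ l = 0)
    {ξ : Fin nx → ℂ} {η : Fin nu → ℂ} (h : ∀ c, ξ ⬝ᵥ x c + η ⬝ᵥ u c = 0) :
    ξ = 0 ∧ η = 0 := by
  set Ac : Matrix (Fin nx) (Fin nx) ℂ := A.map Complex.ofReal with hAc
  set Bc : Matrix (Fin nx) (Fin nu) ℂ := B.map Complex.ofReal with hBc
  set g : ℕ → Fin nu → ℂ := fun j => (ξ ᵥ* Ac ^ j) ᵥ* Bc with hg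
  have hprop : ∀ (l : ℕ) (c : C), (ξ ᵥ* Ac ^ l) ⬝ᵥ x c +
      (∑ i ∈ Finset.range l, z c ^ i * (g (l - 1 - i) ⬝ᵥ u c) + z c ^ l * (η ⬝ᵥ u c)) = 0 := by
    intro l c
    induction l with
    | zero => simpa using h c
    | succ l ih =>
      have h1 : z c * ((ξ ᵥ* Ac ^ l) ⬝ᵥ x c) =
          (ξ ᵥ* Ac ^ (l + 1)) ⬝ᵥ x c + g l ⬝ᵥ u c := by
        rw [← smul_eq_mul, ← dotProduct_smul, hz, dotProduct_add, dotProduct_mulVec,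
          vecMul_vecMul, ← pow_succ, dotProduct_mulVec]
      have h2 : ∑ i ∈ Finset.range (l + 1), z c ^ i * (g (l + 1 - 1 - i) ⬝ᵥ u c) =
          z c * ∑ i ∈ Finset.range l, z c ^ i * (g (l - 1 - i) ⬝ᵥ u c) + g l ⬝ᵥ u c := by
        rw [Finset.sum_range_succ', Finset.mul_sum]
        congr 1
        · refine Finset.sum_congr rfl fun i _ => ?_
          rw [show l + 1 - 1 - (i + 1) = l - 1 - i by omega]
          ring
        · simp
      rw [h2]
      linear_combination z c * ih - h1
  set a : ℕ → ℂ := fun l => Ac.charpoly.coeff l with ha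
  have hdeg : Ac.charpoly.natDegree = nx := by
    rw [charpoly_natDegree_eq_dim, Fintype.card_fin]
  have ha1 : a nx = 1 := by
    have := Ac.charpoly_monic.coeff_natDegree
    rwa [hdeg] at this
  have hCH : ∑ l ∈ Finset.range (nx + 1), a l • Ac ^ l = 0 := by
    have := Ac.aeval_self_charpoly
    rwa [Polynomial.aeval_eq_sum_range, hdeg] at this
  set θ : ℕ → Fin nu → ℂ := fun i =>
    (∑ l ∈ Finset.range (nx + 1), if i < l then a l • g (l - 1 - i) else 0) + a i • η with hθ
  have hθ0 : ∀ i ≤ nx, θ i = 0 := by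
    have := hu (fun l => θ l) ?_
    · exact fun i hi => this ⟨i, by omega⟩
    intro c
    rw [Fin.sum_univ_eq_sum_range (fun l => z c ^ l * (θ l ⬝ᵥ u c))]
    have h1 : ∑ l ∈ Finset.range (nx + 1), a l * ((ξ ᵥ* Ac ^ l) ⬝ᵥ x c) = 0 := by
      have : ∑ l ∈ Finset.range (nx + 1), a l • (ξ ᵥ* Ac ^ l) = 0 := by
        simp only [← vecMul_smul]
        rw [← vecMul_sum, hCH, vecMul_zero]
      simp only [← smul_eq_mul, ← smul_dotProduct]
      rw [← sum_dotProduct, this, zero_dotProduct]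
    have h2 : ∑ l ∈ Finset.range (nx + 1), a l * (∑ i ∈ Finset.range l,
        z c ^ i * (g (l - 1 - i) ⬝ᵥ u c) + z c ^ l * (η ⬝ᵥ u c)) = 0 := by
      have h3 : ∑ l ∈ Finset.range (nx + 1), (a l * ((ξ ᵥ* Ac ^ l) ⬝ᵥ x c) +
          a l * (∑ i ∈ Finset.range l, z c ^ i * (g (l - 1 - i) ⬝ᵥ u c) +
            z c ^ l * (η ⬝ᵥ u c))) = 0 :=
        Finset.sum_eq_zero fun l _ => by linear_combination a l * hprop l c
      rwa [Finset.sum_add_distrib, h1, zero_add] at h3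
    rw [← h2]
    simp only [mul_add, Finset.sum_add_distrib, hθ, add_dotProduct, sum_dotProduct,
      Finset.mul_sum]
    congr 1
    · rw [Finset.sum_comm]
      refine Finset.sum_congr rfl fun l hl => ?_
      have hl' := Finset.mem_range.1 hl
      rw [← Finset.sum_subset (Finset.range_subset_range.2 (by omega : l ≤ nx + 1))]
      · refine Finset.sum_congr rfl fun i hi => ?_
        rw [if_pos (Finset.mem_range.1 hi), smul_dotProduct, smul_eq_mul]
        ring
      · intro i _ hi
        rw [if_neg (by simpa using hi), zero_dotProduct, mul_zero]
    · refine Finset.sum_congr rfl fun l _ => ?_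
      rw [smul_dotProduct, smul_eq_mul]
      ring
  have hη : η = 0 := by
    have := hθ0 nx le_rfl
    simp only [hθ, ha1, one_smul] at this
    rwa [Finset.sum_eq_zero, zero_add] at this
    intro l hl
    rw [if_neg (by have := Finset.mem_range.1 hl; omega)]
  have hg0 : ∀ j < nx, g j = 0 := by
    intro j
    induction j using Nat.strong_induction_on with
    | _ j ih =>
      intro hj
      -- In `θ (nx - 1 - j)` the leading coefficient multiplies `g j`, and the others multiply
      -- `g m` with `m < j`.
      have := hθ0 (nx - 1 - j) (by omega)
      simp only [hθ, hη, smul_zero, add_zero] at this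
      rw [Finset.sum_range_succ, if_pos (by omega), ha1, one_smul,
        show nx - 1 - (nx - 1 - j) = j by omega, Finset.sum_eq_zero, zero_add] at this
      · exact this
      · intro l hl
        have hl' := Finset.mem_range.1 hl
        split_ifs with hlt
        · rw [ih _ (by omega) (by omega), smul_zero]
        · rfl
  refine ⟨eq_zero_of_vecMul_pow_mul_eq_zero hAB fun j hj => ?_, hη⟩
  rw [map_ofReal_mul, map_ofReal_pow, ← vecMul_vecMul]
  exact hg0 j hj

end Excitation

/-! ### The data matrices -/

section DataMatrices

variable {nx nu M E n : ℕ}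

/-- The point of the unit circle that a column of the data matrices belongs to; the mirrored
frequencies have the conjugate points. -/
def colPoint (c : Cols M E) : ℂ :=
  Sum.elim (fun q => gridPoint M (q.1 : Fin M))
    (fun q => starRingEnd ℂ (gridPoint M (q.1 : Fin M))) c

/-- `dataU V` is the depth-one matrix of any family `V`, not only of the inputs. -/
theorem symSpectrumMatrix_apply (L : ℕ) (V : Fin E → Fin M → Fin n → ℂ) (l : Fin L) (i : Fin n)
    (c : Cols M E) :
    symSpectrumMatrix L V (l, i) c = colPoint c ^ (l : ℕ) * dataU V i c := by
  cases c <;> simp [symSpectrumMatrix, spectrumMatrix, dataU, colPoint]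

theorem dataX0_eq_dataU (X : Fin E → Fin M → Fin nx → ℂ) : dataX0 X = dataU X := by
  ext i c
  simp [dataX0, symSpectrumMatrix_apply]

theorem dataX1_apply (X : Fin E → Fin M → Fin nx → ℂ) (i : Fin nx) (c : Cols M E) :
    dataX1 X i c = colPoint c * dataX0 X i c := by
  simp [dataX1, symSpectrumMatrix_apply, dataX0_eq_dataU]

variable {A : Matrix (Fin nx) (Fin nx) ℝ} {B : Matrix (Fin nx) (Fin nu) ℝ}
  {Q : Matrix (Fin nx) (Fin nx) ℝ} {R : Matrix (Fin nu) (Fin nu) ℝ}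
  {U : Fin E → Fin M → Fin nu → ℂ} {X : Fin E → Fin M → Fin nx → ℂ}

/-- The mirrored columns satisfy the state equation as well, because `A` and `B` are real. -/
theorem dataX1_eq (hUX : IsInputStateSpectra A B U X) :
    dataX1 X = A.map Complex.ofReal * dataX0 X + B.map Complex.ofReal * dataU U := by
  ext i c
  rw [dataX1_apply, dataX0_eq_dataU]
  rcases c with ⟨k, e⟩ | ⟨k, e⟩
  · have := congrFun (hUX e k) i
    simpa [mul_apply, colPoint, dataU, symSpectrumMatrix, spectrumMatrix, mulVec,
      dotProduct] using this
  · have := congrArg (starRingEnd ℂ) (congrFun (hUX e k) i)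
    simpa [mul_apply, colPoint, dataU, symSpectrumMatrix, spectrumMatrix, mulVec,
      dotProduct] using this

/-- The state and input data on top of one another have a right inverse. -/
theorem exists_right_inverse_data (hAB : IsControllable A B) (hUX : IsInputStateSpectra A B U X)
    (hU : IsCPE (nx + 1) U) :
    ∃ Z : Matrix (Cols M E) (Fin nx ⊕ Fin nu) ℂ, fromRows (dataX0 X) (dataU U) * Z = 1 := by
  refine exists_right_inverse_of_vecMul fun w hw => ?_
  have hX := dataX1_eq hUX
  have key := eq_zero_of_forall_samples (C := Cols M E) hAB (z := colPoint)
    (x := fun c i => dataX0 X i c) (u := fun c i => dataU U i c) ?_ ?_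
    (ξ := w ∘ Sum.inl) (η := w ∘ Sum.inr) ?_
  · rw [← Sum.elim_comp_inl_inr w, key.1, key.2]
    ext i
    cases i <;> rfl
  · intro c
    ext i
    have := congrFun (congrFun hX i) c
    rw [dataX1_apply] at this
    simpa [mul_apply, mulVec, dotProduct] using this
  · intro θ hθ l
    have := eq_zero_of_vecMul_eq_zero_of_rank (C := symSpectrumMatrix (nx + 1) U)
      (by simpa using hU.2.2) (w := fun p => θ p.1 p.2) ?_
    · ext i
      exact congrFun this (l, i)
    ext c
    rw [Pi.zero_apply, ← hθ c]
    simp only [vecMul, dotProduct, Fintype.sum_prod_type, symSpectrumMatrix_apply,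
      Finset.mul_sum]
    refine Finset.sum_congr rfl fun l _ => Finset.sum_congr rfl fun i _ => by ring
  · intro c
    have := congrFun hw c
    simpa [vecMul, dotProduct, Fintype.sum_sum_type] using this

/-- Substituting the state equation for `X₁` turns the data-based matrix inequality into a
congruence transform of the dissipation inequality. -/
theorem lmiMatrix_eq (hUX : IsInputStateSpectra A B U X) (P : Matrix (Fin nx) (Fin nx) ℝ) :
    lmiMatrix Q R U X P = (fromRows (dataX0 X) (dataU U))ᴴ *
      (dissipationMatrix A B Q R P).map Complex.ofReal * fromRows (dataX0 X) (dataU U) := by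
  simp only [lmiMatrix, dataDelta, Psi, dissipationMatrix, fromBlocks_map,
    conjTranspose_fromRows_eq_fromCols_conjTranspose, fromCols_mul_fromBlocks,
    fromCols_mul_fromRows, dataX1_eq hUX, map_ofReal_add, map_ofReal_sub, map_ofReal_mul,
    Matrix.map_zero _ Complex.ofReal_zero, Matrix.mul_zero, add_zero, zero_add,
    conjTranspose_add, conjTranspose_mul, conjTranspose_map_ofReal, Matrix.add_mul,
    Matrix.mul_add, Matrix.sub_mul, Matrix.mul_sub, Matrix.mul_assoc]
  abel

theorem conjTranspose_mul_cancel {m n l : Type*} [Fintype m] [Fintype n] [DecidableEq m]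
    {Γ : Matrix m n ℂ} {Z : Matrix n m ℂ} (hZ : Γ * Z = 1) (Y : Matrix m l ℂ) :
    Zᴴ * (Γᴴ * Y) = Y := by
  rw [← Matrix.mul_assoc, ← conjTranspose_mul, hZ, conjTranspose_one, Matrix.one_mul]

theorem isFeasible_iff (hUX : IsInputStateSpectra A B U X)
    {Z : Matrix (Cols M E) (Fin nx ⊕ Fin nu) ℂ} (hZ : fromRows (dataX0 X) (dataU U) * Z = 1)
    (P : Matrix (Fin nx) (Fin nx) ℝ) :
    IsFeasible Q R U X P ↔ IsDissipative A B Q R P := by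
  rw [IsFeasible, IsDissipative, ← posSemidef_map_ofReal_iff (S := dissipationMatrix A B Q R P),
    lmiMatrix_eq hUX]
  refine and_congr_left fun _ => ⟨fun h => ?_, fun h => h.conjTranspose_mul_mul_same _⟩
  have := h.conjTranspose_mul_mul_same Z
  rwa [Matrix.mul_assoc, Matrix.mul_assoc, Matrix.mul_assoc, hZ, Matrix.mul_one,
    conjTranspose_mul_cancel hZ] at this

theorem isMaximizer_iff (hUX : IsInputStateSpectra A B U X)
    {Z : Matrix (Cols M E) (Fin nx ⊕ Fin nu) ℂ} (hZ : fromRows (dataX0 X) (dataU U) * Z = 1)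
    (P : Matrix (Fin nx) (Fin nx) ℝ) :
    IsMaximizer Q R U X P ↔ IsMaxDissipative A B Q R P := by
  simp only [IsMaximizer, IsMaxDissipative, isFeasible_iff hUX hZ]

/-- The columns of `[1; K]` lie in the kernel of the dissipation matrix of a Riccati solution,
because the dissipation inequality is an equality on `u = K x`. -/
theorem dissipationMatrix_mul_eq_zero (hR : R.PosDef) {P : Matrix (Fin nx) (Fin nx) ℝ}
    (hP : P.PosSemidef) (hfix : riccatiMap A B Q R P = P) :
    dissipationMatrix A B Q R P *
      fromRows (1 : Matrix (Fin nx) (Fin nx) ℝ) (riccatiGain A B R P) = 0 := by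
  have h1 := mul_riccatiGain (A := A) (B := B) hR hP
  have hPs : Pᵀ = P := isSymm_of_posSemidef hP
  have hRs : Rᵀ = R := isSymm_of_posSemidef hR.posSemidef
  have h2 : (riccatiGain A B R P)ᵀ * (R + Bᵀ * P * B) = -(Aᵀ * P * B) := by
    have := congrArg transpose h1
    simpa [hPs, hRs, Matrix.mul_assoc] using this
  have h3 : Q + Aᵀ * P * A + Aᵀ * P * B * riccatiGain A B R P = P := by
    have h4 := hfix
    rw [riccatiMap, h2, Matrix.neg_mul, sub_neg_eq_add] at h4
    exact h4
  rw [dissipationMatrix, fromBlocks_mul_fromRows, Matrix.mul_one, Matrix.mul_one, h1,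
    add_neg_cancel, sub_add_eq_add_sub, h3, sub_self]
  exact fromRows_zero

/-- The lower block row of the dissipation matrix determines the gain, since `R + Bᵀ P B` is
invertible. -/
theorem gain_eq_of_dissipationMatrix_mul_eq_zero (hR : R.PosDef)
    {P : Matrix (Fin nx) (Fin nx) ℝ} (hP : P.PosSemidef) {K' : Matrix (Fin nu) (Fin nx) ℂ}
    (h : (dissipationMatrix A B Q R P).map Complex.ofReal *
      fromRows (1 : Matrix (Fin nx) (Fin nx) ℂ) K' = 0) :
    (riccatiGain A B R P).map Complex.ofReal = K' := by
  have hu := (isUnit_iff_isUnit_det _).1 (posDef_add_conj (B := B) hR hP).isUnit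
  rw [dissipationMatrix, fromBlocks_map, fromBlocks_mul_fromRows] at h
  have h1 := (fromRows_inj (h.trans fromRows_zero.symm)).2
  rw [Matrix.mul_one, ← neg_neg (Bᵀ * P * A), ← mul_riccatiGain hR hP] at h1
  have h2 : (R + Bᵀ * P * B).map Complex.ofReal * K' =
      (R + Bᵀ * P * B).map Complex.ofReal * (riccatiGain A B R P).map Complex.ofReal := by
    rw [← map_ofReal_mul, ← sub_eq_zero, ← h1]
    ext i j
    simp [sub_eq_add_neg, add_comm]
  have h3 : ((R + Bᵀ * P * B)⁻¹).map Complex.ofReal * (R + Bᵀ * P * B).map Complex.ofReal =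
      1 := by
    rw [← map_ofReal_mul, nonsing_inv_mul _ hu,
      Matrix.map_one _ Complex.ofReal_zero Complex.ofReal_one]
  have h4 := congrArg (((R + Bᵀ * P * B)⁻¹).map Complex.ofReal * ·) h2
  simp only [← Matrix.mul_assoc, h3, Matrix.one_mul] at h4
  exact h4.symm

end DataMatrices

end FreqLQR

end

theorem proposition3 {nx nu M E : ℕ} (hM : 1 ≤ M) (hE : 1 ≤ E)
    (A : Matrix (Fin nx) (Fin nx) ℝ) (B : Matrix (Fin nx) (Fin nu) ℝ)
    (hAB : FreqLQR.IsControllable A B)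
    (Q : Matrix (Fin nx) (Fin nx) ℝ) (hQ : Q.PosSemidef)
    (R : Matrix (Fin nu) (Fin nu) ℝ) (hR : R.PosDef)
    (hobs : FreqLQR.UnitCircleObservable Q A)
    (U : Fin E → Fin M → Fin nu → ℂ) (X : Fin E → Fin M → Fin nx → ℂ)
    (hUX : FreqLQR.IsInputStateSpectra A B U X)
    (hU : FreqLQR.IsCPE (nx + 1) U) :
    ∃ (P : Matrix (Fin nx) (Fin nx) ℝ) (K : Matrix (Fin nu) (Fin nx) ℝ),
      (FreqLQR.IsMaximizer Q R U X P ∧ ∀ P', FreqLQR.IsMaximizer Q R U X P' → P' = P) ∧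
      FreqLQR.IsOptimalControlLaw A B Q R K ∧
      (∃ G : Matrix (FreqLQR.Cols M E) (Fin nx) ℂ,
        FreqLQR.dataX0 X * G = 1 ∧ FreqLQR.lmiMatrix Q R U X P * G = 0 ∧
        K.map Complex.ofReal = FreqLQR.dataU U * G) ∧
      (∀ G : Matrix (FreqLQR.Cols M E) (Fin nx) ℂ,
        FreqLQR.dataX0 X * G = 1 → FreqLQR.lmiMatrix Q R U X P * G = 0 →
        K.map Complex.ofReal = FreqLQR.dataU U * G) := by
  obtain ⟨Z, hZ⟩ := FreqLQR.exists_right_inverse_data hAB hUX hU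
  obtain ⟨P, hmax⟩ := FreqLQR.exists_isMaxDissipative hAB hQ hR
  have hP := hmax.1.2
  have hfix := FreqLQR.riccatiMap_eq_of_isMaxDissipative hQ hR hmax
  have hstab := FreqLQR.tendsto_closedLoop_of_isMaxDissipative hQ hR hobs hmax
  refine ⟨P, FreqLQR.riccatiGain A B R P, ⟨(FreqLQR.isMaximizer_iff hUX hZ P).2 hmax, ?_⟩,
    FreqLQR.isOptimalControlLaw_riccatiGain hQ hR hP hfix hstab, ?_, ?_⟩
  · intro P' hP'
    rw [FreqLQR.isMaximizer_iff hUX hZ] at hP'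
    have hle := FreqLQR.posSemidef_sub_of_isDissipative hQ hR hP hfix hstab hP'.1
    have htr := hP'.2 P hmax.1
    have h0 := hle.trace_eq_zero_iff.1
      (le_antisymm (by rw [Matrix.trace_sub]; linarith) hle.trace_nonneg)
    exact (sub_eq_zero.1 h0).symm
  · set Kc := (FreqLQR.riccatiGain A B R P).map Complex.ofReal
    have hG : Matrix.fromRows (FreqLQR.dataX0 X) (FreqLQR.dataU U) *
        (Z * Matrix.fromRows (1 : Matrix (Fin nx) (Fin nx) ℂ) Kc) =
        Matrix.fromRows (1 : Matrix (Fin nx) (Fin nx) ℂ) Kc := by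
      rw [← Matrix.mul_assoc, hZ, Matrix.one_mul]
    have hker := congrArg (fun S => S.map Complex.ofReal)
      (FreqLQR.dissipationMatrix_mul_eq_zero hR hP hfix)
    rw [FreqLQR.map_ofReal_mul, Matrix.fromRows_map, Matrix.map_one _ Complex.ofReal_zero
      Complex.ofReal_one, Matrix.map_zero _ Complex.ofReal_zero] at hker
    have hGs := hG
    rw [Matrix.fromRows_mul] at hGs
    obtain ⟨h1, h2⟩ := Matrix.fromRows_inj hGs
    refine ⟨_, h1, ?_, h2.symm⟩
    rw [FreqLQR.lmiMatrix_eq hUX, Matrix.mul_assoc, hG, Matrix.mul_assoc, hker, Matrix.mul_zero]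
  · intro G hG1 hG2
    refine FreqLQR.gain_eq_of_dissipationMatrix_mul_eq_zero (Q := Q) hR hP ?_
    rw [FreqLQR.lmiMatrix_eq hUX, Matrix.mul_assoc, Matrix.mul_assoc, Matrix.fromRows_mul,
      hG1] at hG2
    rw [← FreqLQR.conjTranspose_mul_cancel hZ (Matrix.map _ _ * _), hG2, Matrix.mul_zero]
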